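/- Let $X(t)=(X_f(t),X_m(t))$, $t\ge 0$, be a generalized Markov fluid queue of order $n$ with characterizing triple $(Q,\tilde Q,R)$, $R=\mathrm{diag}(r_1,\dots,r_n)$, $r_i\ne 0$: $X_f(t)\ge 0$ is a continuous fluid level; the phase $X_m(t)\in\mathcal S=\{1,\dots,n\}$ jumps according to the generator $Q$ while $X_f(t)>0$ and according to the generator $\tilde Q$ while $X_f(t)=0$; and the fluid level changes at rate $r_i$ in phase $i$, except that it stays at zero when $X_f(t)=0$, $X_m(t)=i$ and $r_i<0$. Suppose that the process has a steady state: for each phase $i$ and each $x\ge 0$, $$\lim_{t\to\infty}\Pr\{X_f(t)\le x,\,X_m(t)=i\}=c_i+\int_0^x f_i(y)\,dy,\qquad c_i=\lim_{t\to\infty}\Pr\{X_f(t)=0,\,X_m(t)=i\},$$ with $\sum_i\bigl(c_i+\int_0^\infty f_i(y)\,dy\bigr)=1$, and that the joint density vector has the matrix-exponential form $$(f_1(x),\dots,f_n(x))=g\,e^{Ax}H,\qquad x\ge 0,$$ for a row vector $g\in\mathbb R^{1\times m}$, a matrix $A\in\mathbb R^{m\times m}$ all of whose eigenvalues have negative real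 part, and a matrix $H\in\mathbb R^{m\times n}$. Let $\mathcal S_0\subset\mathcal S$ be such that $c_i=0$ for all $i\in\mathcal S_0$, let $j\in\mathcal S\setminus\mathcal S_0$, and suppose that $\int_0^\infty\sum_{i\in\mathcal S_0}f_i(x')Q_{ij}\,dx'\ne 0$. Let $$g_j^{\mathcal S_0}(x)=\frac{d}{dx}\lim_{t\to\infty,\ \Delta t\to 0^+}\Pr\{X_f(t)\le x\mid X_m(t)\in\mathcal S_0,\ X_m(t+\Delta t)=j\},\qquad x\ge 0,$$ (a joint limit in $(t,\Delta t)$; the derivative at $x=0$ is one-sided) be the steady-state conditional density of the fluid level just before a transition from $\mathcal S_0$ to $j$. Then the limit and the derivative exist, and for all $x\ge 0$ $$g_j^{\mathcal S_0}(x)=\frac{\sum_{i\in\mathcal S_0}f_i(x)Q_{ij}}{\int_0^\infty\sum_{i\in\mathcal S_0}f_i(x')Q_{ij}\,dx'}=g'e^{Ax}h,$$ where $h=H\eta$, $\eta_i=Q_{ij}$ if $i\in\mathcal S_0$ and $\eta_i=0$ otherwise, and $g'=g/(-gA^{-1}h)$. Moreover $A$ is invertible, $-gA^{-1}h=\int_0^\infty\sum_{i\in\mathcal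 S_0}f_i(x')Q_{ij}\,dx'$, and $x\mapsto g'e^{Ax}h$ is integrable on $(0,\infty)$ with integral $1$. -/

import Mathlib

open MeasureTheory ProbabilityTheory Filter Topology Set
open scoped NNReal Matrix

namespace GMFQ

/-- A (conservative) generator of a continuous-time Markov chain on a finite state space. -/
structure IsGenerator {n : ℕ} (Q : Matrix (Fin n) (Fin n) ℝ) : Prop where
  offDiag_nonneg : ∀ i j, i ≠ j → 0 ≤ Q i j
  row_sum : ∀ i, ∑ j, Q i j = 0

/-- The generator that governs the phase when the fluid level is `x`:
`Q` at a positive level and `Qt` at level zero. -/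
noncomputable def generatorAt {n : ℕ} (Q Qt : Matrix (Fin n) (Fin n) ℝ) (x : ℝ) :
    Matrix (Fin n) (Fin n) ℝ :=
  if x = 0 then Qt else Q

/-- The net rate of change of the fluid at level `x` in phase `i`: the drift `r i`, except that
the fluid sticks to the boundary zero in a phase with negative drift. -/
noncomputable def netRate {n : ℕ} (r : Fin n → ℝ) (x : ℝ) (i : Fin n) : ℝ :=
  if x = 0 ∧ r i < 0 then 0 else r i

/-- The history of the process `(Xf, Xm)`: at time `t` it is the σ-algebra generated by
`(Xf s, Xm s)` for `s ≤ t`. -/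
def history {n : ℕ} {Ω : Type*} [MeasurableSpace Ω] (Xf : ℝ≥0 → Ω → ℝ) (Xm : ℝ≥0 → Ω → Fin n)
    (hf : ∀ t, Measurable (Xf t)) (hm : ∀ t, Measurable (Xm t)) :
    Filtration ℝ≥0 (inferInstance : MeasurableSpace Ω) where
  seq t := ⨆ s ≤ t, MeasurableSpace.comap (fun ω => (Xf s ω, Xm s ω)) inferInstance
  mono' _ _ h := biSup_mono fun _ hs => hs.trans h
  le' _ := iSup₂_le fun s _ => ((hf s).prodMk (hm s)).comap_le

/-- `(Xf, Xm)` is a generalized Markov fluid queue with characterizing triple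
`(Q, Qt, diag r)` under the probability measure `P`, with an arbitrary initial law.

The phase `Xm` is a right-continuous step process, the fluid level `Xf` is nonnegative,
continuous and moves at the rate `netRate`, and the phase jumps according to `Q` while `Xf > 0` and according to `Qt`
while `Xf = 0`.  The last requirement is the martingale problem for the pair: for each phase `j`
the process `𝟙{Xm t = j} - ∫₀ᵗ (generatorAt Q Qt (Xf u)) (Xm u) j du` is a martingale with
respect to the history of `(Xf, Xm)`. -/
structure IsGMFQ {n : ℕ} (Q Qt : Matrix (Fin n) (Fin n) ℝ) (r : Fin n → ℝ)
    {Ω : Type*} [MeasurableSpace Ω] (P : Measure Ω)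
    (Xf : ℝ≥0 → Ω → ℝ) (Xm : ℝ≥0 → Ω → Fin n) : Prop where
  generator : IsGenerator Q
  generator_zero : IsGenerator Qt
  drift_ne_zero : ∀ i, r i ≠ 0
  measurable_fluid : ∀ t, Measurable (Xf t)
  measurable_phase : ∀ t, Measurable (Xm t)
  fluid_nonneg : ∀ t ω, 0 ≤ Xf t ω
  fluid_continuous : ∀ ω, Continuous fun t => Xf t ω
  phase_right_continuous : ∀ ω t, ∀ᶠ s in 𝓝[>] t, Xm s ω = Xm t ω
  phase_left_limit : ∀ ω t, ∃ i, ∀ᶠ s in 𝓝[<] t, Xm s ω = i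
  fluid_eq : ∀ ω (t : ℝ≥0),
    Xf t ω = Xf 0 ω + ∫ u in (0 : ℝ)..t, netRate r (Xf u.toNNReal ω) (Xm u.toNNReal ω)
  phase_martingale : ∀ j : Fin n,
    Martingale
      (fun (t : ℝ≥0) ω => (if Xm t ω = j then (1 : ℝ) else 0) -
        ∫ u in (0 : ℝ)..t, generatorAt Q Qt (Xf u.toNNReal ω) (Xm u.toNNReal ω) j)
      (history Xf Xm measurable_fluid measurable_phase) P

/-- The process has a steady state, with joint densities `f i` on the positive half-line and
probability masses `c i` at level zero: as `t → ∞` the joint distribution function of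
`(Xf t, Xm t)` converges to that of the probability law that has, for phase `i`, the mass `c i` at
level zero and the density `f i` on `(0, ∞)`. -/
structure IsSteadyState {n : ℕ} {Ω : Type*} [MeasurableSpace Ω] (P : Measure Ω)
    (Xf : ℝ≥0 → Ω → ℝ) (Xm : ℝ≥0 → Ω → Fin n) (f : Fin n → ℝ → ℝ) (c : Fin n → ℝ) : Prop where
  mass_zero : ∀ i, Tendsto (fun t => P.real {ω | Xf t ω = 0 ∧ Xm t ω = i}) atTop (𝓝 (c i))
  integrable : ∀ i, IntegrableOn (f i) (Ioi 0)
  cdf : ∀ i x, 0 < x →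
    Tendsto (fun t => P.real {ω | Xf t ω ≤ x ∧ Xm t ω = i}) atTop
      (𝓝 (c i + ∫ y in (0 : ℝ)..x, f i y))
  total : ∑ i, (c i + ∫ y in Ioi 0, f i y) = 1

/-- `φ` is the steady-state conditional density of the fluid level just before a transition from
the set of phases `S₀` to the phase `j`: the conditional probabilities
`P(Xf t ≤ x | Xm t ∈ S₀, Xm (t + Δ) = j)` converge as `t → ∞` and `Δ → 0+` jointly, and the limit,
as a function of `x`, has derivative `φ x` at each `x ≥ 0` (one-sided at `x = 0`). -/
def IsSteadyStateConditionalDensity {n : ℕ} {Ω : Type*} [MeasurableSpace Ω] (P : Measure Ω)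
    (Xf : ℝ≥0 → Ω → ℝ) (Xm : ℝ≥0 → Ω → Fin n) (S₀ : Finset (Fin n)) (j : Fin n)
    (φ : ℝ → ℝ) : Prop :=
  ∃ F : ℝ → ℝ,
    (∀ x, Tendsto
      (fun p : ℝ≥0 × ℝ≥0 =>
        (P[|{ω | Xm p.1 ω ∈ S₀ ∧ Xm (p.1 + p.2) ω = j}]).real {ω | Xf p.1 ω ≤ x})
      (atTop ×ˢ 𝓝[>] 0) (𝓝 (F x))) ∧
    ∀ x, 0 ≤ x → HasDerivWithinAt F (φ x) (Ici 0) x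

/-- A real square matrix is stable if its complex eigenvalues have negative real part. -/
def IsStable {m : ℕ} (A : Matrix (Fin m) (Fin m) ℝ) : Prop :=
  ∀ z ∈ spectrum ℂ (A.map (algebraMap ℝ ℂ)), z.re < 0

/-- The matrix-exponential function `x ↦ g e^{Ax} h`, for a row vector `g` and a column
vector `h`. -/
noncomputable def matExp {m : ℕ} (g : Fin m → ℝ) (A : Matrix (Fin m) (Fin m) ℝ)
    (h : Fin m → ℝ) (x : ℝ) : ℝ :=
  g ⬝ᵥ (NormedSpace.exp (x • A) *ᵥ h)

/-- The column vector `η` of the rates into phase `j` from the phases in `S₀`. -/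
def rateVec {n : ℕ} (Q : Matrix (Fin n) (Fin n) ℝ) (S₀ : Finset (Fin n)) (j : Fin n) :
    Fin n → ℝ :=
  fun i => if i ∈ S₀ then Q i j else 0

end GMFQ

/-! The probabilistic core is a first-order expansion of transition probabilities. Let `E` be an
event of the history up to `t` on which the phase lies in `S₀`. Since `j ∉ S₀`, the martingale
property writes the probability of `E` and phase `j` at `t + Δ` as the expected integral of the jump
rate into `j` over `[t, t + Δ]` on `E`. Replacing that rate by `Q (Xm t) j` costs something only if
the phase has already changed, which has probability O(Δ), or if the fluid has reached zero, which
forces `Xf t ≤ R Δ` because paths are Lipschitz. The latter event, within `S₀`, has vanishing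
probability in the joint limit because `c i = 0` there. Hence the probability divided by Δ converges
(`tendsto_transition_rate`). Taking `E` with and without the constraint `Xf t ≤ x` and dividing
gives the limiting conditional distribution function, which the fundamental theorem of calculus
differentiates.

The normalizing constant is the integral of `g e^{Ax} h`. Its primitive `g e^{Ax} A⁻¹ h` converges
because the densities are integrable, and invertibility of `A` alone forces the limit to be zero
(`tendsto_matExp_zero`); stability is needed only to make `A` invertible. -/

namespace GMFQ

/-! ### Matrix-exponential functions and their integrals -/

section MatrixExponential

variable {m : ℕ}

theorem IsStable.isUnit_det {A : Matrix (Fin m) (Fin m) ℝ} (hA : IsStable A) : IsUnit A.det := by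
  have h0 : (0 : ℂ) ∉ spectrum ℂ (A.map (algebraMap ℝ ℂ)) := fun h => by simpa using hA 0 h
  rw [spectrum.zero_notMem_iff, Matrix.isUnit_iff_isUnit_det, isUnit_iff_ne_zero] at h0
  rw [isUnit_iff_ne_zero]
  intro h
  apply h0
  have := (RingHom.map_det (algebraMap ℝ ℂ) A).symm
  rw [h, map_zero] at this
  exact this

theorem matExp_add (g : Fin m → ℝ) (A : Matrix (Fin m) (Fin m) ℝ) (v w : Fin m → ℝ) (x : ℝ) :
    matExp g A (v + w) x = matExp g A v x + matExp g A w x := by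
  simp [matExp, Matrix.mulVec_add]

theorem matExp_smul (g : Fin m → ℝ) (A : Matrix (Fin m) (Fin m) ℝ) (a : ℝ) (v : Fin m → ℝ)
    (x : ℝ) : matExp g A (a • v) x = a * matExp g A v x := by
  simp [matExp, Matrix.mulVec_smul]

theorem smul_matExp (g : Fin m → ℝ) (A : Matrix (Fin m) (Fin m) ℝ) (a : ℝ) (v : Fin m → ℝ)
    (x : ℝ) : matExp (a • g) A v x = a * matExp g A v x := by
  simp [matExp]

theorem matExp_zero (g : Fin m → ℝ) (A : Matrix (Fin m) (Fin m) ℝ) (v : Fin m → ℝ) :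
    matExp g A v 0 = g ⬝ᵥ v := by
  simp [matExp, NormedSpace.exp_zero]

theorem matExp_exp_mulVec (g : Fin m → ℝ) (A : Matrix (Fin m) (Fin m) ℝ) (v : Fin m → ℝ)
    (t x : ℝ) : matExp g A (NormedSpace.exp (t • A) *ᵥ v) x = matExp g A v (x + t) := by
  rw [matExp, matExp, Matrix.mulVec_mulVec, add_smul, Matrix.exp_add_of_commute]
  exact ((Commute.refl A).smul_left x).smul_right t

open scoped Matrix.Norms.Operator in
theorem hasDerivAt_exp_smul (A : Matrix (Fin m) (Fin m) ℝ) (x : ℝ) :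
    HasDerivAt (fun u : ℝ => NormedSpace.exp (u • A)) (NormedSpace.exp (x • A) * A) x :=
  hasDerivAt_exp_smul_const A x

open scoped Matrix.Norms.Operator in
theorem hasDerivAt_matExp (g : Fin m → ℝ) (A : Matrix (Fin m) (Fin m) ℝ) (v : Fin m → ℝ)
    (x : ℝ) : HasDerivAt (matExp g A v) (matExp g A (A *ᵥ v) x) x := by
  let L : Matrix (Fin m) (Fin m) ℝ →ₗ[ℝ] ℝ :=
    { toFun := fun M => g ⬝ᵥ (M *ᵥ v)
      map_add' := fun M N => by simp [Matrix.add_mulVec]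
      map_smul' := fun a M => by simp [Matrix.smul_mulVec] }
  have h := (LinearMap.toContinuousLinearMap L).hasFDerivAt.comp_hasDerivAt x
    (hasDerivAt_exp_smul A x)
  have e : matExp g A (A *ᵥ v) x = L (NormedSpace.exp (x • A) * A) := by
    simp [L, matExp, Matrix.mulVec_mulVec]
  rw [e]
  exact h

theorem continuous_matExp (g : Fin m → ℝ) (A : Matrix (Fin m) (Fin m) ℝ) (v : Fin m → ℝ) :
    Continuous (matExp g A v) :=
  continuous_iff_continuousAt.2 fun x => (hasDerivAt_matExp g A v x).continuousAt

open scoped Matrix.Norms.Operator in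
-- The difference quotient `t⁻¹ (e^{tA} - 1)` tends to `A` as `t → 0`, and the determinant is
-- continuous, so any small enough nonzero `t` works.
theorem exists_det_exp_sub_one_ne_zero {A : Matrix (Fin m) (Fin m) ℝ} (hA : A.det ≠ 0) :
    ∃ t : ℝ, (NormedSpace.exp (t • A) - 1).det ≠ 0 := by
  have h := (hasDerivAt_exp_smul A 0).tendsto_slope_zero
  simp only [zero_add, zero_smul, NormedSpace.exp_zero, one_mul] at h
  have hdet : Continuous fun M : Matrix (Fin m) (Fin m) ℝ => M.det :=
    continuous_id.matrix_det
  obtain ⟨t, ht⟩ := (((hdet.tendsto A).comp h).eventually_ne hA).exists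
  refine ⟨t, fun h0 => ht ?_⟩
  simp [h0]

/-- The vectors `v` for which `g e^{Ax} v` converges as `x → ∞`. -/
def convergentSubmodule (g : Fin m → ℝ) (A : Matrix (Fin m) (Fin m) ℝ) :
    Submodule ℝ (Fin m → ℝ) where
  carrier := {v | ∃ l, Tendsto (matExp g A v) atTop (𝓝 l)}
  add_mem' := by
    rintro v w ⟨a, ha⟩ ⟨b, hb⟩
    exact ⟨a + b, (ha.add hb).congr fun x => (matExp_add g A v w x).symm⟩
  zero_mem' := ⟨0, by simp [show matExp g A 0 = fun _ => 0 by ext; simp [matExp]]⟩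
  smul_mem' := by
    rintro a v ⟨b, hb⟩
    exact ⟨a * b, (hb.const_mul a).congr fun x => (matExp_smul g A a v x).symm⟩

/-- Multiplying `v` by `e^{tA}` shifts the argument by `t`, so this is the difference of a
convergent function and its translate. -/
theorem tendsto_matExp_exp_mulVec_sub {g : Fin m → ℝ} {A : Matrix (Fin m) (Fin m) ℝ}
    {v : Fin m → ℝ} (hv : v ∈ convergentSubmodule g A) (t : ℝ) :
    Tendsto (matExp g A ((NormedSpace.exp (t • A) - 1) *ᵥ v)) atTop (𝓝 0) := by
  obtain ⟨l, hl⟩ := hv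
  have h := (hl.comp (tendsto_atTop_add_const_right atTop t tendsto_id)).sub hl
  rw [sub_self] at h
  refine h.congr fun x => ?_
  rw [Matrix.sub_mulVec, Matrix.one_mulVec]
  refine sub_eq_of_eq_add ?_
  rw [← matExp_add, sub_add_cancel, matExp_exp_mulVec]
  rfl

/-- If `A` is invertible, then `g e^{Ax} v` tends to zero as soon as it converges. -/
theorem tendsto_matExp_zero {g : Fin m → ℝ} {A : Matrix (Fin m) (Fin m) ℝ} (hA : A.det ≠ 0)
    {v : Fin m → ℝ} (hv : v ∈ convergentSubmodule g A) :
    Tendsto (matExp g A v) atTop (𝓝 0) := by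
  obtain ⟨t, ht⟩ := exists_det_exp_sub_one_ne_zero hA
  set D := NormedSpace.exp (t • A) - 1 with hD
  -- `D` maps the convergent vectors into those with limit zero, hence into the same subspace. Being
  -- injective on a finite-dimensional space, the restriction is onto, so every convergent `v` is `D
  -- w` with `w` convergent and has limit zero.
  let T : convergentSubmodule g A →ₗ[ℝ] convergentSubmodule g A :=
    (Matrix.mulVecLin D).restrict fun w hw => ⟨0, tendsto_matExp_exp_mulVec_sub hw t⟩
  have hinj : Function.Injective T := by
    intro a b hab
    have h' : D *ᵥ (a : Fin m → ℝ) = D *ᵥ (b : Fin m → ℝ) := congrArg Subtype.val hab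
    exact Subtype.ext (Matrix.mulVec_injective_of_isUnit
      ((Matrix.isUnit_iff_isUnit_det D).2 (isUnit_iff_ne_zero.2 ht)) h')
  obtain ⟨w, hw⟩ := LinearMap.injective_iff_surjective.1 hinj ⟨v, hv⟩
  have h' : D *ᵥ (w : Fin m → ℝ) = v := congrArg Subtype.val hw
  rw [← h']
  exact tendsto_matExp_exp_mulVec_sub w.2 t

/-- `g e^{Ax} A⁻¹ v` is a primitive; integrability makes it converge at infinity, and then its limit
is zero. -/
theorem integral_matExp {g : Fin m → ℝ} {A : Matrix (Fin m) (Fin m) ℝ} (hA : IsUnit A.det)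
    {v : Fin m → ℝ} (hint : IntegrableOn (matExp g A v) (Ioi 0)) :
    ∫ x in Ioi (0 : ℝ), matExp g A v x = -(g ⬝ᵥ (A⁻¹ *ᵥ v)) := by
  have hd : ∀ x, HasDerivAt (matExp g A (A⁻¹ *ᵥ v)) (matExp g A v x) x := by
    intro x
    have h := hasDerivAt_matExp g A (A⁻¹ *ᵥ v) x
    rwa [Matrix.mulVec_mulVec, Matrix.mul_nonsing_inv A hA, Matrix.one_mulVec] at h
  have hlim := tendsto_limUnder_of_hasDerivAt_of_integrableOn_Ioi (fun x _ => hd x) hint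
  have h0 := tendsto_matExp_zero hA.ne_zero (v := A⁻¹ *ᵥ v) ⟨_, hlim⟩
  rw [integral_Ioi_of_hasDerivAt_of_tendsto (hd 0).continuousAt.continuousWithinAt
    (fun x _ => hd x) hint h0, matExp_zero, zero_sub]

theorem matExp_mulVec {n : ℕ} (g : Fin m → ℝ) (A : Matrix (Fin m) (Fin m) ℝ)
    (H : Matrix (Fin m) (Fin n) ℝ) (η : Fin n → ℝ) (x : ℝ) :
    matExp g A (H *ᵥ η) x = ∑ i, matExp g A (H.col i) x * η i := by
  have e : H *ᵥ η = ∑ i, η i • H.col i := by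
    ext k
    simp [Matrix.mulVec, dotProduct, Matrix.col, mul_comm]
  rw [e, matExp, Matrix.mulVec_sum, dotProduct_sum]
  simp [matExp, Matrix.mulVec_smul, mul_comm]

end MatrixExponential

/-! ### Joint measurability in time and outcome -/

theorem measurable_uncurry_of_right_continuous {Ω β : Type*} [MeasurableSpace Ω]
    [TopologicalSpace β] [TopologicalSpace.PseudoMetrizableSpace β] [MeasurableSpace β]
    [BorelSpace β] {X : ℝ≥0 → Ω → β} (hX : ∀ t, Measurable (X t))
    (hc : ∀ ω t, Tendsto (fun s => X s ω) (𝓝[>] t) (𝓝 (X t ω))) :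
    Measurable (Function.uncurry X) := by
  -- Dyadic-style approximation on the grid of mesh `1/(k+1)`. The `+ 1` after the floor keeps the
  -- grid point strictly to the right of `u`, as a limit along `𝓝[>] u` requires.
  have hρ : ∀ u, Tendsto (fun k : ℕ => ((⌊((k : ℝ≥0) + 1) * u⌋₊ : ℝ≥0) + 1) / (k + 1)) atTop
      (𝓝[>] u) := by
    intro u
    have hfl := fun k : ℕ => Nat.lt_floor_add_one (((k : ℝ≥0) + 1) * u)
    refine tendsto_nhdsWithin_iff.2 ⟨?_, Eventually.of_forall fun k => ?_⟩
    · have h1 : Tendsto (fun k : ℕ => u + 1 / ((k : ℝ≥0) + 1)) atTop (𝓝 (u + 0)) :=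
        tendsto_const_nhds.add tendsto_one_div_add_atTop_nhds_zero_nat
      rw [add_zero] at h1
      refine tendsto_of_tendsto_of_tendsto_of_le_of_le tendsto_const_nhds h1 (fun k => ?_)
        (fun k => ?_)
      · rw [le_div_iff₀ (by positivity), mul_comm]
        exact (hfl k).le
      · rw [div_le_iff₀ (by positivity), add_mul u, one_div,
          inv_mul_cancel₀ (by positivity), mul_comm u]
        gcongr
        exact Nat.floor_le zero_le
    · rw [mem_Ioi, lt_div_iff₀ (by positivity), mul_comm]
      exact hfl k
  have hmeas : ∀ (k : ℕ) (a : ℕ → ℝ≥0),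
      Measurable fun p : ℝ≥0 × Ω => X (a ⌊((k : ℝ≥0) + 1) * p.1⌋₊) p.2 := by
    intro k a
    have h1 : Measurable fun q : ℕ × Ω => X (a q.1) q.2 :=
      measurable_from_prod_countable_right fun i => hX (a i)
    have h2 : Measurable fun p : ℝ≥0 × Ω => (⌊((k : ℝ≥0) + 1) * p.1⌋₊, p.2) :=
      (Nat.measurable_floor.comp (measurable_fst.const_mul _)).prodMk measurable_snd
    exact h1.comp h2
  exact measurable_of_tendsto_metrizable
    (fun k => hmeas k fun i => ((i : ℝ≥0) + 1) / (k + 1))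
    (tendsto_pi_nhds.2 fun p => (hc p.2 p.1).comp (hρ p.1))

/-! ### Short-time behaviour of the fluid queue -/

namespace IsGMFQ

variable {n : ℕ} {Q Qt : Matrix (Fin n) (Fin n) ℝ} {r : Fin n → ℝ} {Ω : Type*}
  [MeasurableSpace Ω] {P : Measure Ω} {Xf : ℝ≥0 → Ω → ℝ} {Xm : ℝ≥0 → Ω → Fin n}

theorem measurable_uncurry_fluid (hX : IsGMFQ Q Qt r P Xf Xm) :
    Measurable (Function.uncurry Xf) :=
  measurable_uncurry_of_right_continuous hX.measurable_fluid fun ω t =>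
    ((hX.fluid_continuous ω).tendsto t).mono_left nhdsWithin_le_nhds

theorem measurable_uncurry_phase (hX : IsGMFQ Q Qt r P Xf Xm) :
    Measurable (Function.uncurry Xm) :=
  measurable_uncurry_of_right_continuous hX.measurable_phase fun ω t =>
    tendsto_const_nhds.congr' ((hX.phase_right_continuous ω t).mono fun _ h => h.symm)

theorem measurable_comp (hX : IsGMFQ Q Qt r P Xf Xm) {G : ℝ → Fin n → ℝ}
    (hG : ∀ i, Measurable fun x => G x i) :
    Measurable fun p : Ω × ℝ => G (Xf p.2.toNNReal p.1) (Xm p.2.toNNReal p.1) := by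
  have h1 : Measurable fun q : ℝ × Fin n => G q.1 q.2 := measurable_from_prod_countable_left hG
  have h2 : Measurable fun p : Ω × ℝ => (p.2.toNNReal, p.1) :=
    measurable_snd.real_toNNReal.prodMk measurable_fst
  exact h1.comp ((hX.measurable_uncurry_fluid.comp h2).prodMk
    (hX.measurable_uncurry_phase.comp h2))

theorem intervalIntegrable_comp (hX : IsGMFQ Q Qt r P Xf Xm) {G : ℝ → Fin n → ℝ}
    (hG : ∀ i, Measurable fun x => G x i) {C : ℝ} (hC : ∀ x i, |G x i| ≤ C) (ω : Ω) (a b : ℝ) :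
    IntervalIntegrable (fun u => G (Xf u.toNNReal ω) (Xm u.toNNReal ω)) volume a b := by
  rw [intervalIntegrable_iff]
  refine Measure.integrableOn_of_bounded (M := C) (by simp)
    ((hX.measurable_comp hG).comp measurable_prodMk_left).aestronglyMeasurable
    (Eventually.of_forall fun u => hC _ _)

theorem integrable_comp_prod [IsFiniteMeasure P] (hX : IsGMFQ Q Qt r P Xf Xm)
    {G : ℝ → Fin n → ℝ} (hG : ∀ i, Measurable fun x => G x i) {C : ℝ}
    (hC : ∀ x i, |G x i| ≤ C) (E : Set Ω) (a b : ℝ) :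
    Integrable (fun p : Ω × ℝ => G (Xf p.2.toNNReal p.1) (Xm p.2.toNNReal p.1))
      ((P.restrict E).prod (volume.restrict (Ioc a b))) :=
  Integrable.of_bound (hX.measurable_comp hG).aestronglyMeasurable C
    (Eventually.of_forall fun _ => hC _ _)

theorem measurable_generatorAt (Q Qt : Matrix (Fin n) (Fin n) ℝ) (i j : Fin n) :
    Measurable fun x => generatorAt Q Qt x i j := by
  have e : (fun x => generatorAt Q Qt x i j) = fun x => if x = 0 then Qt i j else Q i j := by
    ext x; unfold generatorAt; split_ifs <;> rfl
  rw [e]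
  exact Measurable.ite (measurableSet_singleton 0) measurable_const measurable_const

theorem exists_generatorAt_bound (Q Qt : Matrix (Fin n) (Fin n) ℝ) :
    ∃ C, 0 ≤ C ∧ ∀ x i j, |generatorAt Q Qt x i j| ≤ C := by
  refine ⟨∑ i, ∑ j, (|Q i j| + |Qt i j|), by positivity, fun x i j => ?_⟩
  have h1 : |Q i j| + |Qt i j| ≤ ∑ j, (|Q i j| + |Qt i j|) :=
    Finset.single_le_sum (f := fun j => |Q i j| + |Qt i j|) (fun _ _ => by positivity)
      (Finset.mem_univ j)
  have h2 : ∑ j, (|Q i j| + |Qt i j|) ≤ ∑ i, ∑ j, (|Q i j| + |Qt i j|) :=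
    Finset.single_le_sum (f := fun i => ∑ j, (|Q i j| + |Qt i j|)) (fun _ _ => by positivity)
      (Finset.mem_univ i)
  have h3 : |generatorAt Q Qt x i j| ≤ |Q i j| + |Qt i j| := by
    have := abs_nonneg (Q i j)
    have := abs_nonneg (Qt i j)
    unfold generatorAt
    split_ifs <;> linarith
  linarith

/-- The net rate is bounded by `∑ i, |r i|`, uniformly in the path. This keeps the fluid positive
for a time Δ when it starts above `R Δ`. -/
theorem exists_fluid_lipschitz (hX : IsGMFQ Q Qt r P Xf Xm) :
    ∃ R, 0 ≤ R ∧ ∀ ω (t s : ℝ≥0), t ≤ s → |Xf s ω - Xf t ω| ≤ R * (s - t) := by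
  have hb : ∀ x i, |netRate r x i| ≤ ∑ i, |r i| := by
    intro x i
    have h1 : |r i| ≤ ∑ i, |r i| :=
      Finset.single_le_sum (f := fun i => |r i|) (fun _ _ => abs_nonneg _) (Finset.mem_univ i)
    have := abs_nonneg (r i)
    unfold netRate
    split_ifs
    · rw [abs_zero]; linarith
    · exact h1
  have hmeas : ∀ i, Measurable fun x => netRate r x i := fun i =>
    Measurable.ite ((measurableSet_singleton 0).inter (MeasurableSet.const _)) measurable_const
      measurable_const
  refine ⟨∑ i, |r i|, by positivity, fun ω t s hts => ?_⟩
  have hi := hX.intervalIntegrable_comp hmeas hb ω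
  rw [hX.fluid_eq ω s, hX.fluid_eq ω t, add_sub_add_left_eq_sub,
    intervalIntegral.integral_interval_sub_left (hi _ _) (hi _ _)]
  have h := intervalIntegral.norm_integral_le_of_norm_le_const (a := t) (b := s)
    (f := fun u => netRate r (Xf u.toNNReal ω) (Xm u.toNNReal ω)) (C := ∑ i, |r i|)
    fun u _ => hb _ _
  rwa [abs_of_nonneg (sub_nonneg.2 (NNReal.coe_le_coe.2 hts))] at h

theorem measurableSet_history (hX : IsGMFQ Q Qt r P Xf Xm) (t : ℝ≥0) {B : Set (ℝ × Fin n)}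
    (hB : MeasurableSet B) :
    MeasurableSet[history Xf Xm hX.measurable_fluid hX.measurable_phase t]
      {ω | (Xf t ω, Xm t ω) ∈ B} :=
  (le_iSup₂_of_le (f := fun s (_ : s ≤ t) =>
    MeasurableSpace.comap (fun ω => (Xf s ω, Xm s ω)) inferInstance) t le_rfl le_rfl) _
    ⟨B, hB, rfl⟩

/-- The compensator identity for the jumps into phase `j` on an event `E` of the past. -/
theorem prob_phase_sub [IsProbabilityMeasure P] (hX : IsGMFQ Q Qt r P Xf Xm) {t s : ℝ≥0}
    (hts : t ≤ s) {E : Set Ω}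
    (hE : MeasurableSet[history Xf Xm hX.measurable_fluid hX.measurable_phase t] E) (j : Fin n) :
    P.real (E ∩ {ω | Xm s ω = j}) - P.real (E ∩ {ω | Xm t ω = j}) =
      ∫ ω in E, (∫ u in (t : ℝ)..s,
        generatorAt Q Qt (Xf u.toNNReal ω) (Xm u.toNNReal ω) j) ∂P := by
  obtain ⟨C, hC0, hC⟩ := exists_generatorAt_bound Q Qt
  have hG := fun i => measurable_generatorAt Q Qt i j
  have hi := hX.intervalIntegrable_comp hG (C := C) (fun x i => hC x i j)
  have hm := (hX.phase_martingale j).setIntegral_eq hts hE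
  have hind : ∀ t, Integrable (fun ω => if Xm t ω = j then (1 : ℝ) else 0) (P.restrict E) := by
    intro t
    refine Integrable.of_bound (C := 1) (Measurable.aestronglyMeasurable (Measurable.ite
      (hX.measurable_phase t (measurableSet_singleton j)) measurable_const measurable_const))
      (Eventually.of_forall fun ω => ?_)
    split_ifs <;> simp
  have hval : ∀ t, ∫ ω in E, (if Xm t ω = j then (1 : ℝ) else 0) ∂P =
      P.real (E ∩ {ω | Xm t ω = j}) := by
    intro t
    have hms : MeasurableSet {ω | Xm t ω = j} :=
      hX.measurable_phase t (measurableSet_singleton j)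
    have e : (fun ω => if Xm t ω = j then (1 : ℝ) else 0) = {ω | Xm t ω = j}.indicator 1 := by
      ext ω; simp [Set.indicator]
    rw [e, integral_indicator_one hms, measureReal_restrict_apply hms, inter_comm]
  have hint : ∀ a b : ℝ≥0, Integrable (fun ω => ∫ u in (a : ℝ)..b,
      generatorAt Q Qt (Xf u.toNNReal ω) (Xm u.toNNReal ω) j) (P.restrict E) := by
    intro a b
    simp only [intervalIntegral]
    exact ((hX.integrable_comp_prod hG (fun x i => hC x i j) E _ _).integral_prod_left).sub
      ((hX.integrable_comp_prod hG (fun x i => hC x i j) E _ _).integral_prod_left)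
  have h0 := fun a : ℝ≥0 => hint 0 a
  simp only [NNReal.coe_zero] at h0
  rw [integral_sub (hind t) (h0 t), integral_sub (hind s) (h0 s), hval, hval] at hm
  have e : ∀ ω, ∫ u in (t : ℝ)..s, generatorAt Q Qt (Xf u.toNNReal ω) (Xm u.toNNReal ω) j =
      (∫ u in (0 : ℝ)..s, generatorAt Q Qt (Xf u.toNNReal ω) (Xm u.toNNReal ω) j) -
      ∫ u in (0 : ℝ)..t, generatorAt Q Qt (Xf u.toNNReal ω) (Xm u.toNNReal ω) j := fun ω =>
    (intervalIntegral.integral_interval_sub_left (hi ω _ _) (hi ω _ _)).symm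
  simp only [e]
  rw [integral_sub (h0 s) (h0 t)]
  linarith

theorem sum_prob_phase [IsProbabilityMeasure P] (hX : IsGMFQ Q Qt r P Xf Xm) (t : ℝ≥0) :
    ∑ k, P.real {ω | Xm t ω = k} = 1 := by
  have := sum_measureReal_preimage_singleton (μ := P) (f := Xm t) Finset.univ
    fun k _ => hX.measurable_phase t (measurableSet_singleton k)
  simpa [Set.preimage] using this

/-- The compensator identity with `E = {Xm t = k}` and target `k` bounds the loss of mass from phase
`k`; summing over `k` costs nothing, since the phase probabilities add up to one. -/
theorem prob_phase_ne_le [IsProbabilityMeasure P] (hX : IsGMFQ Q Qt r P Xf Xm) {C : ℝ}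
    (hC : ∀ x i j, |generatorAt Q Qt x i j| ≤ C) {t s : ℝ≥0} (hts : t ≤ s) :
    P.real {ω | Xm s ω ≠ Xm t ω} ≤ C * (s - t) := by
  have hms : ∀ t k, MeasurableSet {ω | Xm t ω = k} := fun t k =>
    hX.measurable_phase t (measurableSet_singleton k)
  have hk : ∀ k, P.real ({ω | Xm t ω = k} ∩ {ω | Xm s ω ≠ k}) ≤
      C * (s - t) * P.real {ω | Xm t ω = k} := by
    intro k
    have hE := hX.measurableSet_history t (B := {p | p.2 = k})
      (measurable_snd (measurableSet_singleton k))
    have h := hX.prob_phase_sub hts hE k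
    simp only [mem_ofPred_eq, inter_self] at h
    have h1 : P.real ({ω | Xm t ω = k} ∩ {ω | Xm s ω = k}) +
        P.real ({ω | Xm t ω = k} ∩ {ω | Xm s ω ≠ k}) = P.real {ω | Xm t ω = k} :=
      measureReal_inter_add_sdiff (hms s k)
    have h2 := norm_setIntegral_le_of_norm_le_const (μ := P) (s := {ω | Xm t ω = k})
      (f := fun ω => ∫ u in (t : ℝ)..s, generatorAt Q Qt (Xf u.toNNReal ω) (Xm u.toNNReal ω) k)
      (C := C * (s - t)) (measure_lt_top _ _) fun ω _ => by
        have := intervalIntegral.norm_integral_le_of_norm_le_const (a := t) (b := s)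
          (f := fun u => generatorAt Q Qt (Xf u.toNNReal ω) (Xm u.toNNReal ω) k) (C := C)
          fun u _ => hC _ _ _
        rwa [abs_of_nonneg (sub_nonneg.2 (NNReal.coe_le_coe.2 hts))] at this
    rw [← h, Real.norm_eq_abs, abs_le] at h2
    linarith [h2.1]
  calc P.real {ω | Xm s ω ≠ Xm t ω}
      ≤ P.real (⋃ k, {ω | Xm t ω = k} ∩ {ω | Xm s ω ≠ k}) :=
        measureReal_mono (fun ω hω => mem_iUnion.2 ⟨Xm t ω, rfl, hω⟩)
    _ ≤ ∑ k, P.real ({ω | Xm t ω = k} ∩ {ω | Xm s ω ≠ k}) := measureReal_iUnion_fintype_le _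
    _ ≤ ∑ k, C * (s - t) * P.real {ω | Xm t ω = k} := Finset.sum_le_sum fun k _ => hk k
    _ = C * (s - t) := by rw [← Finset.mul_sum, hX.sum_prob_phase, mul_one]

theorem setIntegral_phase [IsProbabilityMeasure P] (hX : IsGMFQ Q Qt r P Xf Xm) (t : ℝ≥0)
    {E : Set Ω} (w : Fin n → ℝ) :
    Integrable (fun ω => w (Xm t ω)) (P.restrict E) ∧
      ∫ ω in E, w (Xm t ω) ∂P = ∑ i, w i * P.real (E ∩ {ω | Xm t ω = i}) := by
  have hms : ∀ i, MeasurableSet {ω | Xm t ω = i} := fun i =>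
    hX.measurable_phase t (measurableSet_singleton i)
  have e : (fun ω => w (Xm t ω)) = fun ω => ∑ i, {ω | Xm t ω = i}.indicator (fun _ => w i) ω := by
    ext ω
    simp [Set.indicator]
  have hi : ∀ i, Integrable ({ω | Xm t ω = i}.indicator fun _ => w i) (P.restrict E) := fun i =>
    (integrable_const _).indicator (hms i)
  rw [e]
  refine ⟨integrable_finsetSum _ fun i _ => hi i, ?_⟩
  rw [integral_finsetSum _ fun i _ => hi i]
  refine Finset.sum_congr rfl fun i _ => ?_
  rw [integral_indicator (hms i), setIntegral_const, measureReal_restrict_apply (hms i),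
    inter_comm, smul_eq_mul, mul_comm]

/-- On an event `E` of the past that avoids phase `j`, the probability of being in phase `j` a
short time later is given by the rates in `Q`, up to an error that is controlled by the
probability that the fluid level is close to zero. -/
theorem abs_prob_phase_sub_le [IsProbabilityMeasure P] (hX : IsGMFQ Q Qt r P Xf Xm) {C R : ℝ}
    (hC : ∀ x i j, |generatorAt Q Qt x i j| ≤ C)
    (hR : ∀ ω (t s : ℝ≥0), t ≤ s → |Xf s ω - Xf t ω| ≤ R * (s - t)) (hR0 : 0 ≤ R)
    {t s : ℝ≥0} (hts : t ≤ s) {E : Set Ω}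
    (hE : MeasurableSet[history Xf Xm hX.measurable_fluid hX.measurable_phase t] E) {j : Fin n}
    (hEj : ∀ ω ∈ E, Xm t ω ≠ j) :
    |P.real (E ∩ {ω | Xm s ω = j}) - (s - t) * ∑ i, Q i j * P.real (E ∩ {ω | Xm t ω = i})| ≤
      2 * C * (C * (s - t) + P.real (E ∩ {ω | Xf t ω ≤ R * (s - t)})) * (s - t) := by
  have hts' : (t : ℝ) ≤ s := NNReal.coe_le_coe.2 hts
  have hG := fun i => measurable_generatorAt Q Qt i j
  have hprod := hX.integrable_comp_prod hG (fun x i => hC x i j) E t s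
  have hEm : MeasurableSet E :=
    (history Xf Xm hX.measurable_fluid hX.measurable_phase).le t _ hE
  -- The level 1 stands for any positive level, where the generator is `Q`.
  have hCQ : ∀ i, |Q i j| ≤ C := fun i => by simpa [generatorAt] using hC 1 i j
  have h0 : P.real (E ∩ {ω | Xm t ω = j}) = 0 := by
    have : E ∩ {ω | Xm t ω = j} = ∅ :=
      eq_empty_of_forall_notMem fun ω hω => hEj ω hω.1 hω.2
    rw [this, measureReal_empty]
  have h1 := hX.prob_phase_sub hts hE j
  rw [h0, sub_zero] at h1
  -- Fubini moves the time integral outside, so that it suffices to compare the expected rates at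
  -- each fixed time `u` in `(t, s]`.
  obtain ⟨hQi, hQ⟩ := hX.setIntegral_phase t (E := E) fun i => Q i j
  have h2 : ∫ ω in E, (∫ u in (t : ℝ)..s,
      generatorAt Q Qt (Xf u.toNNReal ω) (Xm u.toNNReal ω) j) ∂P =
      ∫ u in (t : ℝ)..s, (∫ ω in E,
        generatorAt Q Qt (Xf u.toNNReal ω) (Xm u.toNNReal ω) j ∂P) := by
    simp only [intervalIntegral.integral_of_le hts']
    exact integral_integral_swap hprod
  have hii : IntervalIntegrable (fun u : ℝ => ∫ ω in E,
      generatorAt Q Qt (Xf u.toNNReal ω) (Xm u.toNNReal ω) j ∂P) volume t s := by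
    rw [intervalIntegrable_iff_integrableOn_Ioc_of_le hts']
    exact hprod.integral_prod_right
  have h3 : (s - t : ℝ) * ∑ i, Q i j * P.real (E ∩ {ω | Xm t ω = i}) =
      ∫ _ in (t : ℝ)..s, (∫ ω in E, Q (Xm t ω) j ∂P) := by
    rw [intervalIntegral.integral_const, hQ, smul_eq_mul]
  rw [h1, h2, h3, ← intervalIntegral.integral_sub hii intervalIntegrable_const]
  rw [← Real.norm_eq_abs]
  refine (intervalIntegral.norm_integral_le_of_norm_le_const
    (C := 2 * C * (C * (s - t) + P.real (E ∩ {ω | Xf t ω ≤ R * (s - t)}))) fun u hu => ?_).trans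
    (by rw [abs_of_nonneg (sub_nonneg.2 hts')])
  rw [uIoc_of_le hts'] at hu
  obtain ⟨v, rfl⟩ : ∃ v : ℝ≥0, (v : ℝ) = u :=
    ⟨⟨u, t.2.trans hu.1.le⟩, rfl⟩
  have htv : t ≤ v := NNReal.coe_le_coe.1 hu.1.le
  rw [Real.toNNReal_coe]
  have hGi : Integrable (fun ω => generatorAt Q Qt (Xf v ω) (Xm v ω) j) (P.restrict E) := by
    have hmeas := (hX.measurable_comp hG).comp (measurable_prodMk_right (y := (v : ℝ)))
    simp only [Function.comp_def, Real.toNNReal_coe] at hmeas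
    exact Integrable.of_bound hmeas.aestronglyMeasurable C
      (Eventually.of_forall fun ω => hC _ _ _)
  have hB1 : MeasurableSet {ω | Xm v ω ≠ Xm t ω} :=
    (measurableSet_eq_fun (hX.measurable_phase v) (hX.measurable_phase t)).compl
  have hB2 : MeasurableSet {ω | Xf t ω ≤ R * (s - t)} :=
    measurableSet_le (hX.measurable_fluid t) measurable_const
  -- Off the two exceptional events the phase is unchanged and the fluid is still positive at `v`,
  -- so the rates agree; on them the difference is at most `2 * C`.
  have hpt : ∀ ω, ‖generatorAt Q Qt (Xf v ω) (Xm v ω) j - Q (Xm t ω) j‖ ≤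
      2 * C * ({ω | Xm v ω ≠ Xm t ω}.indicator 1 ω +
        {ω | Xf t ω ≤ R * (s - t)}.indicator 1 ω) := by
    intro ω
    have hC0 : 0 ≤ C := (abs_nonneg _).trans (hCQ j)
    have hle : ‖generatorAt Q Qt (Xf v ω) (Xm v ω) j - Q (Xm t ω) j‖ ≤ 2 * C :=
      (norm_sub_le _ _).trans (by
        rw [Real.norm_eq_abs, Real.norm_eq_abs, two_mul]
        exact add_le_add (hC _ _ _) (hCQ _))
    by_cases hm : Xm v ω = Xm t ω
    · by_cases hf : Xf t ω ≤ R * (s - t)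
      · simpa [Set.indicator, hm, hf] using hle
      · have hlip := hR ω t v htv
        have hmono : R * (v - t : ℝ) ≤ R * (s - t) :=
          mul_le_mul_of_nonneg_left (sub_le_sub_right hu.2 _) hR0
        have hne : Xf v ω ≠ 0 := by
          rw [abs_le] at hlip
          push Not at hf
          intro h0
          rw [h0] at hlip
          linarith [hlip.1]
        simp [Set.indicator, hm, hf, generatorAt, hne]
    · have : (0 : ℝ) ≤ {ω | Xf t ω ≤ R * (s - t)}.indicator 1 ω :=
        Set.indicator_nonneg (fun _ _ => zero_le_one) _
      rw [Set.indicator_of_mem (show ω ∈ {ω | Xm v ω ≠ Xm t ω} from hm), Pi.one_apply]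
      nlinarith
  have hi1 : Integrable ({ω | Xm v ω ≠ Xm t ω}.indicator (1 : Ω → ℝ)) (P.restrict E) :=
    (integrable_const (1 : ℝ)).indicator hB1
  have hi2 : Integrable ({ω | Xf t ω ≤ R * (s - t)}.indicator (1 : Ω → ℝ)) (P.restrict E) :=
    (integrable_const (1 : ℝ)).indicator hB2
  rw [← integral_sub hGi hQi]
  refine (norm_integral_le_of_norm_le ((hi1.add hi2).const_mul (2 * C))
    (Eventually.of_forall hpt)).trans ?_
  have hC0 : 0 ≤ C := (abs_nonneg _).trans (hCQ j)
  have hsum := integral_add hi1 hi2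
  simp only [Pi.add_apply]
  rw [integral_const_mul, hsum, integral_indicator_one hB1, integral_indicator_one hB2,
    measureReal_restrict_apply hB1, measureReal_restrict_apply hB2,
    inter_comm {ω | Xf t ω ≤ R * (s - t)}]
  have hv := hX.prob_phase_ne_le hC htv
  have hv' : C * (v - t : ℝ) ≤ C * (s - t) :=
    mul_le_mul_of_nonneg_left (sub_le_sub_right hu.2 _) hC0
  have hsub : P.real ({ω | Xm v ω ≠ Xm t ω} ∩ E) ≤ P.real {ω | Xm v ω ≠ Xm t ω} :=
    measureReal_mono inter_subset_left
  gcongr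
  linarith

end IsGMFQ

/-! ### Steady-state limits -/

theorem tendsto_of_sum_eq_of_eventually_gt {ι α : Type*} [Fintype ι] {l : Filter α}
    {u : ι → α → ℝ} {p : ι → ℝ} (hsum : ∀ t, ∑ i, u i t = ∑ i, p i)
    (hlow : ∀ i, ∀ a < p i, ∀ᶠ t in l, a < u i t) (i : ι) : Tendsto (u i) l (𝓝 (p i)) := by
  refine tendsto_order.2 ⟨hlow i, fun a ha => ?_⟩
  have hN : (0 : ℝ) < Fintype.card ι := Nat.cast_pos.2 (Fintype.card_pos_iff.2 ⟨i⟩)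
  -- With a fixed total, an excess in one coordinate must be offset by deficits in the others. If
  -- every coordinate falls short by less than `δ`, the nonnegative terms `u k t - p k + δ` add up
  -- to `card ι * δ = a - p i`, which caps `u i t` at `a - δ`.
  set δ := (a - p i) / Fintype.card ι with hδ
  have hδ0 : 0 < δ := div_pos (sub_pos.2 ha) hN
  have hNδ : Fintype.card ι * δ = a - p i := mul_div_cancel₀ _ hN.ne'
  filter_upwards [eventually_all.2 fun k => hlow k (p k - δ) (sub_lt_self _ hδ0)] with t ht
  have h1 : u i t - p i + δ ≤ ∑ k, (u k t - p k + δ) :=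
    Finset.single_le_sum (f := fun k => u k t - p k + δ) (fun k _ => by linarith [ht k])
      (Finset.mem_univ i)
  rw [Finset.sum_add_distrib, Finset.sum_sub_distrib, hsum t, sub_self, zero_add,
    Finset.sum_const, nsmul_eq_mul, Finset.card_univ, hNδ] at h1
  linarith

section SteadyState

variable {n : ℕ} {Q Qt : Matrix (Fin n) (Fin n) ℝ} {r : Fin n → ℝ} {Ω : Type*}
  [MeasurableSpace Ω] {P : Measure Ω} {Xf : ℝ≥0 → Ω → ℝ} {Xm : ℝ≥0 → Ω → Fin n}
  {f : Fin n → ℝ → ℝ} {c : Fin n → ℝ}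

/-- The distribution functions bound the phase probability from below at each finite level; no mass
escapes to infinity because the limiting masses sum to one. -/
theorem IsSteadyState.tendsto_prob_phase [IsProbabilityMeasure P] (hX : IsGMFQ Q Qt r P Xf Xm)
    (hfc : IsSteadyState P Xf Xm f c) (i : Fin n) :
    Tendsto (fun t => P.real {ω | Xm t ω = i}) atTop (𝓝 (c i + ∫ y in Ioi 0, f i y)) := by
  refine tendsto_of_sum_eq_of_eventually_gt (u := fun i t => P.real {ω | Xm t ω = i})
    (p := fun i => c i + ∫ y in Ioi 0, f i y)
    (fun t => (hX.sum_prob_phase t).trans hfc.total.symm) (fun i a ha => ?_) i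
  have h1 : Tendsto (fun x : ℝ => c i + ∫ y in (0 : ℝ)..x, f i y) atTop
      (𝓝 (c i + ∫ y in Ioi 0, f i y)) :=
    (intervalIntegral_tendsto_integral_Ioi 0 (hfc.integrable i) tendsto_id).const_add _
  obtain ⟨x, hax, hx⟩ := ((h1.eventually_const_lt ha).and (eventually_gt_atTop 0)).exists
  filter_upwards [(hfc.cdf i x hx).eventually_const_lt hax] with t ht
  exact ht.trans_le (measureReal_mono fun ω hω => hω.2)

theorem IsSteadyState.tendsto_primitive (hfc : IsSteadyState P Xf Xm f c) (i : Fin n) :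
    Tendsto (fun x : ℝ => ∫ y in (0 : ℝ)..x, f i y) (𝓝[>] 0) (𝓝 0) := by
  have h1 : IntegrableOn (f i) (uIcc 0 1) := by
    rw [uIcc_of_le zero_le_one]
    exact ((integrableOn_Ici_iff_integrableOn_Ioi (by simp)).2 (hfc.integrable i)).mono_set Icc_subset_Ici_self
  have h2 := intervalIntegral.continuousOn_primitive_interval h1 0 left_mem_uIcc
  rw [uIcc_of_le zero_le_one] at h2
  have h3 : Tendsto (fun x : ℝ => ∫ y in (0 : ℝ)..x, f i y) (𝓝[Icc 0 1] 0)
      (𝓝 (∫ y in (0 : ℝ)..0, f i y)) := h2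
  rw [intervalIntegral.integral_same] at h3
  refine h3.mono_left ?_
  rw [← nhdsWithin_Ioc_eq_nhdsGT zero_lt_one]
  exact nhdsWithin_mono _ Ioc_subset_Icc_self

theorem IsSteadyState.tendsto_prob_near_zero [IsProbabilityMeasure P]
    (hfc : IsSteadyState P Xf Xm f c) {S₀ : Finset (Fin n)} (hS₀ : ∀ i ∈ S₀, c i = 0) (R : ℝ) :
    Tendsto (fun p : ℝ≥0 × ℝ≥0 => P.real {ω | Xm p.1 ω ∈ S₀ ∧ Xf p.1 ω ≤ R * p.2})
      (atTop ×ˢ 𝓝[>] 0) (𝓝 0) := by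
  refine tendsto_order.2 ⟨fun a ha => Eventually.of_forall fun p =>
    ha.trans_le measureReal_nonneg, fun a ha => ?_⟩
  have h1 : Tendsto (fun x : ℝ => ∑ i ∈ S₀, (c i + ∫ y in (0 : ℝ)..x, f i y)) (𝓝[>] 0)
      (𝓝 (∑ i ∈ S₀, (c i + 0))) :=
    tendsto_finsetSum _ fun i _ => (hfc.tendsto_primitive i).const_add _
  rw [Finset.sum_eq_zero fun i hi => by rw [hS₀ i hi, add_zero]] at h1
  -- The level `x` is fixed before time and step: then `t` large controls the probability below `x`,
  -- and Δ small gives `R Δ < x`, independently of each other. This makes the limit joint.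
  obtain ⟨x, hxa, hx⟩ := ((h1.eventually_lt_const ha).and self_mem_nhdsWithin).exists
  have h2 : Tendsto (fun t => ∑ i ∈ S₀, P.real {ω | Xf t ω ≤ x ∧ Xm t ω = i}) atTop
      (𝓝 (∑ i ∈ S₀, (c i + ∫ y in (0 : ℝ)..x, f i y))) :=
    tendsto_finsetSum _ fun i _ => hfc.cdf i x hx
  have h3 : ∀ᶠ Δ : ℝ≥0 in 𝓝[>] 0, R * Δ < x := by
    have : Tendsto (fun Δ : ℝ≥0 => R * (Δ : ℝ)) (𝓝 0) (𝓝 (R * ((0 : ℝ≥0) : ℝ))) :=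
      (continuous_const.mul NNReal.continuous_coe).tendsto 0
    rw [NNReal.coe_zero, mul_zero] at this
    exact (this.eventually_lt_const hx).filter_mono nhdsWithin_le_nhds
  filter_upwards [(h2.eventually_lt_const hxa).prod_mk h3] with p hp
  refine lt_of_le_of_lt ?_ hp.1
  calc P.real {ω | Xm p.1 ω ∈ S₀ ∧ Xf p.1 ω ≤ R * p.2}
      ≤ P.real (⋃ i ∈ S₀, {ω | Xf p.1 ω ≤ x ∧ Xm p.1 ω = i}) :=
        measureReal_mono (h₂ := measure_ne_top _ _) (fun ω hω =>
          mem_biUnion (x := Xm p.1 ω) hω.1 ⟨hω.2.trans hp.2.le, rfl⟩)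
    _ ≤ _ := measureReal_biUnion_finset_le _ _

/-- The intensity of transitions from `S₀` to `j` on events `E t` of the past at time `t`. -/
theorem IsSteadyState.tendsto_transition_rate [IsProbabilityMeasure P]
    (hX : IsGMFQ Q Qt r P Xf Xm) (hfc : IsSteadyState P Xf Xm f c) {S₀ : Finset (Fin n)}
    (hS₀ : ∀ i ∈ S₀, c i = 0) {j : Fin n} (hj : j ∉ S₀) {E : ℝ≥0 → Set Ω}
    (hE : ∀ t, MeasurableSet[history Xf Xm hX.measurable_fluid hX.measurable_phase t] (E t))
    (hES : ∀ t, ∀ ω ∈ E t, Xm t ω ∈ S₀) {q : Fin n → ℝ}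
    (hq : ∀ i ∈ S₀, Tendsto (fun t => P.real (E t ∩ {ω | Xm t ω = i})) atTop (𝓝 (q i))) :
    Tendsto (fun p : ℝ≥0 × ℝ≥0 => P.real (E p.1 ∩ {ω | Xm (p.1 + p.2) ω = j}) / p.2)
      (atTop ×ˢ 𝓝[>] 0) (𝓝 (∑ i ∈ S₀, Q i j * q i)) := by
  obtain ⟨C, hC0, hC⟩ := IsGMFQ.exists_generatorAt_bound Q Qt
  obtain ⟨R, hR0, hR⟩ := hX.exists_fluid_lipschitz
  have hmain : Tendsto (fun p : ℝ≥0 × ℝ≥0 => ∑ i ∈ S₀, Q i j *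
      P.real (E p.1 ∩ {ω | Xm p.1 ω = i})) (atTop ×ˢ 𝓝[>] 0) (𝓝 (∑ i ∈ S₀, Q i j * q i)) :=
    (tendsto_finsetSum _ fun i hi => (hq i hi).const_mul (Q i j)).comp tendsto_fst
  have hΔ : Tendsto (fun p : ℝ≥0 × ℝ≥0 => (p.2 : ℝ)) (atTop ×ˢ 𝓝[>] 0) (𝓝 0) :=
    ((NNReal.continuous_coe.tendsto 0).mono_left nhdsWithin_le_nhds).comp tendsto_snd
  have herr := ((hΔ.const_mul C).add (hfc.tendsto_prob_near_zero hS₀ R)).const_mul (2 * C)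
  rw [mul_zero, add_zero, mul_zero] at herr
  have hpos : ∀ᶠ p : ℝ≥0 × ℝ≥0 in atTop ×ˢ 𝓝[>] 0, 0 < p.2 :=
    tendsto_snd.eventually self_mem_nhdsWithin
  refine tendsto_of_tendsto_of_dist hmain (squeeze_zero' (Eventually.of_forall fun _ =>
    dist_nonneg) ?_ herr)
  filter_upwards [hpos] with p hp
  have hp' : (0 : ℝ) < p.2 := NNReal.coe_pos.2 hp
  have h := hX.abs_prob_phase_sub_le hC hR hR0 (le_add_of_nonneg_right hp.le : p.1 ≤ p.1 + p.2)
    (hE p.1) (j := j) (fun ω hω hωj => hj (hωj ▸ hES p.1 ω hω))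
  rw [NNReal.coe_add, add_sub_cancel_left] at h
  have hS : ∑ i, Q i j * P.real (E p.1 ∩ {ω | Xm p.1 ω = i}) =
      ∑ i ∈ S₀, Q i j * P.real (E p.1 ∩ {ω | Xm p.1 ω = i}) := by
    refine (Finset.sum_subset (Finset.subset_univ _) fun i _ hi => ?_).symm
    have : E p.1 ∩ {ω | Xm p.1 ω = i} = ∅ :=
      eq_empty_of_forall_notMem fun ω hω => hi ((show Xm p.1 ω = i from hω.2) ▸ hES p.1 ω hω.1)
    rw [this, measureReal_empty, mul_zero]
  have hsub : P.real (E p.1 ∩ {ω | Xf p.1 ω ≤ R * p.2}) ≤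
      P.real {ω | Xm p.1 ω ∈ S₀ ∧ Xf p.1 ω ≤ R * p.2} :=
    measureReal_mono fun ω hω => ⟨hES _ ω hω.1, hω.2⟩
  rw [hS] at h
  rw [dist_comm, Real.dist_eq, div_sub' hp'.ne', abs_div, abs_of_pos hp', div_le_iff₀ hp']
  refine h.trans ?_
  gcongr

/-- The conditional distribution function of the fluid level just before a transition from `S₀`
to `j` converges. -/
theorem IsSteadyState.tendsto_cond_cdf [IsProbabilityMeasure P]
    (hX : IsGMFQ Q Qt r P Xf Xm) (hfc : IsSteadyState P Xf Xm f c) {S₀ : Finset (Fin n)}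
    (hS₀ : ∀ i ∈ S₀, c i = 0) {j : Fin n} (hj : j ∉ S₀)
    (hpos : ∑ i ∈ S₀, Q i j * ∫ y in Ioi 0, f i y ≠ 0) (x : ℝ) :
    Tendsto
      (fun p : ℝ≥0 × ℝ≥0 =>
        (P[|{ω | Xm p.1 ω ∈ S₀ ∧ Xm (p.1 + p.2) ω = j}]).real {ω | Xf p.1 ω ≤ x})
      (atTop ×ˢ 𝓝[>] 0)
      (𝓝 ((∑ i ∈ S₀, Q i j * ∫ y in (0 : ℝ)..max x 0, f i y) /
        ∑ i ∈ S₀, Q i j * ∫ y in Ioi 0, f i y)) := by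
  have hS : ∀ t, MeasurableSet {ω | Xm t ω ∈ S₀} := fun t =>
    hX.measurable_phase t (Set.toFinite (S₀ : Set (Fin n))).measurableSet
  have hnum := hfc.tendsto_transition_rate hX hS₀ hj
    (E := fun t => {ω | Xm t ω ∈ S₀ ∧ Xf t ω ≤ x}) (q := fun i => ∫ y in (0 : ℝ)..max x 0, f i y)
    (fun t => hX.measurableSet_history t (B := {p | p.2 ∈ S₀ ∧ p.1 ≤ x})
      ((measurable_snd (Set.toFinite (S₀ : Set (Fin n))).measurableSet).inter
        (measurable_fst measurableSet_Iic)))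
    (fun t ω hω => hω.1) (fun i hi => by
      have e : ∀ t, {ω | Xm t ω ∈ S₀ ∧ Xf t ω ≤ x} ∩ {ω | Xm t ω = i} =
          {ω | Xf t ω ≤ x ∧ Xm t ω = i} := by
        intro t
        ext ω
        constructor
        · rintro ⟨⟨_, h1⟩, h2⟩
          exact ⟨h1, h2⟩
        · rintro ⟨h1, h2⟩
          exact ⟨⟨(show Xm t ω = i from h2).symm ▸ hi, h1⟩, h2⟩
      simp only [e]
      -- The limit of the distribution function is assumed only at positive levels; level zero
      -- relies on the atom `c i = 0`, and negative levels have probability zero.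
      rcases lt_trichotomy x 0 with hx | rfl | hx
      · have e' : ∀ t, {ω | Xf t ω ≤ x ∧ Xm t ω = i} = ∅ := fun t =>
          eq_empty_of_forall_notMem fun ω hω => absurd (hX.fluid_nonneg t ω)
            (not_le.2 (lt_of_le_of_lt hω.1 hx))
        simp [e', max_eq_right hx.le]
      · have e' : ∀ t, {ω | Xf t ω ≤ 0 ∧ Xm t ω = i} = {ω | Xf t ω = 0 ∧ Xm t ω = i} := by
          intro t
          ext ω
          exact and_congr_left fun _ =>
            ⟨fun h => le_antisymm h (hX.fluid_nonneg t ω), fun h => h.le⟩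
        have := hfc.mass_zero i
        rw [hS₀ i hi] at this
        simpa [e'] using this
      · have := hfc.cdf i x hx
        rw [hS₀ i hi, zero_add] at this
        simpa [max_eq_left hx.le] using this)
  have hden := hfc.tendsto_transition_rate hX hS₀ hj
    (E := fun t => {ω | Xm t ω ∈ S₀}) (q := fun i => ∫ y in Ioi 0, f i y)
    (fun t => hX.measurableSet_history t (B := {p | p.2 ∈ S₀})
      (measurable_snd (Set.toFinite (S₀ : Set (Fin n))).measurableSet))
    (fun t ω hω => hω) (fun i hi => by
      have e : ∀ t, {ω | Xm t ω ∈ S₀} ∩ {ω | Xm t ω = i} = {ω | Xm t ω = i} := fun t =>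
        inter_eq_right.2 fun ω (hω : Xm t ω = i) => show Xm t ω ∈ S₀ from hω.symm ▸ hi
      have := hfc.tendsto_prob_phase hX i
      rw [hS₀ i hi, zero_add] at this
      simpa only [e] using this)
  refine (hnum.div hden hpos).congr' ?_
  filter_upwards [(tendsto_snd.eventually self_mem_nhdsWithin :
    ∀ᶠ p : ℝ≥0 × ℝ≥0 in atTop ×ˢ 𝓝[>] 0, 0 < p.2)] with p hp
  have hp' : (p.2 : ℝ) ≠ 0 := (NNReal.coe_pos.2 hp).ne'
  have hms : MeasurableSet {ω | Xm p.1 ω ∈ S₀ ∧ Xm (p.1 + p.2) ω = j} :=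
    (hS p.1).inter (hX.measurable_phase _ (measurableSet_singleton j))
  have e1 : {ω | Xm p.1 ω ∈ S₀ ∧ Xm (p.1 + p.2) ω = j} ∩ {ω | Xf p.1 ω ≤ x} =
      {ω | Xm p.1 ω ∈ S₀ ∧ Xf p.1 ω ≤ x} ∩ {ω | Xm (p.1 + p.2) ω = j} := by
    ext ω
    exact and_right_comm
  -- The factors Δ cancel. The quotient formula also holds when the conditioning event is null: both
  -- sides are then zero.
  rw [Pi.div_apply, div_div_div_cancel_right₀ hp', measureReal_def, measureReal_def,
    measureReal_def, cond_apply hms, e1, ENNReal.toReal_mul, ENNReal.toReal_inv, mul_comm,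
    div_eq_mul_inv]
  rfl

/-- `max x 0` makes the distribution function vanish at negative levels. The values of `φ` there are
arbitrary, so the continuous `ψ` takes its place for the fundamental theorem of calculus. -/
theorem hasDerivWithinAt_primitive_max {φ ψ : ℝ → ℝ} (hψ : Continuous ψ)
    (h : ∀ x, 0 ≤ x → φ x = ψ x) {x : ℝ} (hx : 0 ≤ x) :
    HasDerivWithinAt (fun x : ℝ => ∫ y in (0 : ℝ)..max x 0, φ y) (φ x) (Ici 0) x := by
  have e : ∀ x, 0 ≤ x → ∫ y in (0 : ℝ)..max x 0, φ y = ∫ y in (0 : ℝ)..x, ψ y := by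
    intro x hx
    rw [max_eq_left hx]
    refine intervalIntegral.integral_congr fun y hy => ?_
    rw [uIcc_of_le hx] at hy
    exact h y hy.1
  rw [h x hx]
  exact (hψ.integral_hasStrictDerivAt 0 x).hasDerivAt.hasDerivWithinAt.congr e (e x hx)

end SteadyState

end GMFQ

/-! ### The conditional density and its matrix-exponential form -/

theorem theorem1 {n m : ℕ} (Q Qt : Matrix (Fin n) (Fin n) ℝ) (r : Fin n → ℝ)
    {Ω : Type*} [MeasurableSpace Ω] (P : Measure Ω) [IsProbabilityMeasure P]
    (Xf : ℝ≥0 → Ω → ℝ) (Xm : ℝ≥0 → Ω → Fin n)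
    (hX : GMFQ.IsGMFQ Q Qt r P Xf Xm)
    (f : Fin n → ℝ → ℝ) (c : Fin n → ℝ) (hfc : GMFQ.IsSteadyState P Xf Xm f c)
    (g : Fin m → ℝ) (A : Matrix (Fin m) (Fin m) ℝ) (H : Matrix (Fin m) (Fin n) ℝ)
    (hA : GMFQ.IsStable A)
    (hf : ∀ i x, 0 ≤ x → f i x = GMFQ.matExp g A (H.col i) x)
    (S₀ : Finset (Fin n)) (hS₀ : ∀ i ∈ S₀, c i = 0) (j : Fin n) (hj : j ∉ S₀)
    (hpos : ∫ y in Ioi (0 : ℝ), ∑ i ∈ S₀, f i y * Q i j ≠ 0)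
    (η : Fin n → ℝ) (hη : η = GMFQ.rateVec Q S₀ j)
    (h : Fin m → ℝ) (hh : h = H *ᵥ η)
    (g' : Fin m → ℝ) (hg' : g' = (-(g ⬝ᵥ (A⁻¹ *ᵥ h)))⁻¹ • g) :
    GMFQ.IsSteadyStateConditionalDensity P Xf Xm S₀ j
        (fun x => (∑ i ∈ S₀, f i x * Q i j) / ∫ y in Ioi (0 : ℝ), ∑ i ∈ S₀, f i y * Q i j) ∧
      (∀ x, 0 ≤ x →
        (∑ i ∈ S₀, f i x * Q i j) / (∫ y in Ioi (0 : ℝ), ∑ i ∈ S₀, f i y * Q i j) =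
          GMFQ.matExp g' A h x) ∧
      IsUnit A.det ∧
      ∫ y in Ioi (0 : ℝ), ∑ i ∈ S₀, f i y * Q i j = -(g ⬝ᵥ (A⁻¹ *ᵥ h)) ∧
      IntegrableOn (GMFQ.matExp g' A h) (Ioi 0) ∧
      ∫ x in Ioi (0 : ℝ), GMFQ.matExp g' A h x = 1 := by

  have hdet := hA.isUnit_det
  have hfint : ∀ i ∈ S₀, Integrable (fun y => f i y * Q i j) (volume.restrict (Ioi 0)) :=
    fun i _ => (hfc.integrable i).mul_const _
  have hD : ∫ y in Ioi (0 : ℝ), ∑ i ∈ S₀, f i y * Q i j =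
      ∑ i ∈ S₀, Q i j * ∫ y in Ioi 0, f i y := by
    rw [integral_finsetSum _ hfint]
    exact Finset.sum_congr rfl fun i _ => by rw [integral_mul_const, mul_comm]
  have hφ : ∀ x, 0 ≤ x → ∑ i ∈ S₀, f i x * Q i j = GMFQ.matExp g A h x := by
    intro x hx
    rw [hh, hη, GMFQ.matExp_mulVec]
    simp only [GMFQ.rateVec, mul_ite, mul_zero, Finset.sum_ite_mem, Finset.univ_inter]
    exact Finset.sum_congr rfl fun i _ => by rw [hf i x hx]
  -- Integrability comes from the steady-state densities rather than from a decay estimate for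
  -- `e^{Ax}`.
  have hint : IntegrableOn (GMFQ.matExp g A h) (Ioi 0) :=
    IntegrableOn.congr_fun (integrable_finsetSum _ hfint) (fun x hx => hφ x (le_of_lt hx))
      measurableSet_Ioi
  have hDh : ∫ y in Ioi (0 : ℝ), ∑ i ∈ S₀, f i y * Q i j = -(g ⬝ᵥ (A⁻¹ *ᵥ h)) :=
    (setIntegral_congr_fun measurableSet_Ioi fun x hx => hφ x (le_of_lt hx)).trans
      (GMFQ.integral_matExp hdet hint)
  have hne : -(g ⬝ᵥ (A⁻¹ *ᵥ h)) ≠ 0 := hDh ▸ hpos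
  have hg'e : GMFQ.matExp g' A h =
      fun x => (-(g ⬝ᵥ (A⁻¹ *ᵥ h)))⁻¹ * GMFQ.matExp g A h x := by
    ext x
    rw [hg', GMFQ.smul_matExp]
  refine ⟨⟨_, hfc.tendsto_cond_cdf hX hS₀ hj (hD ▸ hpos), fun x hx => ?_⟩, fun x hx => ?_, hdet,
    hDh, ?_, ?_⟩
  · rw [← hD]
    refine HasDerivWithinAt.div_const ?_ _
    simp only [mul_comm (f _ x)]
    exact HasDerivWithinAt.fun_sum fun i _ => (GMFQ.hasDerivWithinAt_primitive_max
      (GMFQ.continuous_matExp g A (H.col i)) (hf i) hx).const_mul (Q i j)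
  · rw [hφ x hx, hDh, hg'e, div_eq_inv_mul]
  · rw [hg'e]
    exact hint.const_mul _
  · rw [hg'e, integral_const_mul, GMFQ.integral_matExp hdet hint, inv_mul_cancel₀ hne]
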